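/- By a finite graph we mean a finite graph in which loops, multiple edges and isolated vertices are allowed, regarded as a topological space: each edge is a copy of the segment $[0,1]$, whose ends are glued to the end vertices of the edge. The degree of a vertex is the number of edge ends at it (a loop counts twice). The star $T_n$ is the graph consisting of a centre joined by $n$ edges to $n$ further vertices. Let $X$, $Y$ and $K$ be finite graphs. A basic embedding of $K$ into $X\times Y$ is a topological embedding $\varphi:K\to X\times Y$ such that for every continuous function $f:\varphi(K)\to\mathbb R$ there are continuous functions $g:X\to\mathbb R$ and $h:Y\to\mathbb R$ with $f(x,y)=g(x)+h(y)$ for all $(x,y)\in\varphi(K)$. A map $\varphi:K\to X\times Y$ is piecewise linear if both of its coordinate maps $K\to X$ and $K\to Y$ are; a map of graphs is piecewise linear if each edge of the source can be subdivided into finitely many segments, each of which is mapped into a single vertex or, affinely in the edge parameters, into a single closed edge of the target. **Theorem.** Let $X$ and $Y$ be finite graphs. (1) There is a finite graph that has no basic embedding (piecewise linear or not) into $X\times Y$. (2) Let $k$ be the maximal degree of a vertex of $X$ or $Y$ (the maximum taken over all vertices of both graphs, and $0$ if there are none). Then the star $T_{4k^2+1}$ has no basic embedding into $X\times Y$ that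 is piecewise linear. -/

import Mathlib

universe u v w

/-- A finite graph; loops, multiple edges and isolated vertices are allowed. Every edge carries an
auxiliary direction (from `src` to `tgt`), which only serves to parametrise it by `[0, 1]`. -/
structure FiniteGraph where
  V : Type u
  E : Type u
  [fintypeV : Fintype V]
  [fintypeE : Fintype E]
  src : E → V
  tgt : E → V

namespace FiniteGraph

attribute [instance] fintypeV fintypeE

instance (G : FiniteGraph.{u}) : TopologicalSpace G.V := ⊥

instance (G : FiniteGraph.{u}) : TopologicalSpace G.E := ⊥

instance (G : FiniteGraph.{u}) : DiscreteTopology G.V := ⟨rfl⟩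

instance (G : FiniteGraph.{u}) : DiscreteTopology G.E := ⟨rfl⟩

/-- The degree of a vertex: the number of edge ends at it, so that a loop counts twice. -/
noncomputable def degree (G : FiniteGraph.{u}) (a : G.V) : ℕ :=
  Nat.card {e : G.E // G.src e = a} + Nat.card {e : G.E // G.tgt e = a}

/-- The maximal degree of a vertex (`0` for the graph without vertices). -/
noncomputable def maxDegree (G : FiniteGraph.{u}) : ℕ :=
  Finset.univ.sup G.degree

/-- The identifications that build the topological graph: the two ends of each segment
`{e} × [0, 1]` are glued to the end vertices of `e`. -/
inductive Glue (G : FiniteGraph.{u}) :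
    G.V ⊕ (G.E × unitInterval) → G.V ⊕ (G.E × unitInterval) → Prop
  | src (e : G.E) : Glue G (Sum.inr (e, 0)) (Sum.inl (G.src e))
  | tgt (e : G.E) : Glue G (Sum.inr (e, 1)) (Sum.inl (G.tgt e))

/-- The graph as a topological space (a one-dimensional CW complex), with the quotient topology. -/
def Realization (G : FiniteGraph.{u}) : Type u :=
  Quot G.Glue

instance (G : FiniteGraph.{u}) : TopologicalSpace G.Realization :=
  inferInstanceAs (TopologicalSpace (Quot G.Glue))

/-- A vertex, as a point of the topological graph. -/
def vertexPoint (G : FiniteGraph.{u}) (a : G.V) : G.Realization :=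
  Quot.mk G.Glue (Sum.inl a)

/-- The point with parameter `t` on the edge `e`. -/
def edgePoint (G : FiniteGraph.{u}) (e : G.E) (t : unitInterval) : G.Realization :=
  Quot.mk G.Glue (Sum.inr (e, t))

/-- The star `T_n`: a centre `none` joined by `n` edges to `n` other vertices. -/
def starGraph (n : ℕ) : FiniteGraph.{0} where
  V := Option (Fin n)
  E := Fin n
  src := fun _ => none
  tgt := fun i => some i

/-- On the parameter interval `[a, b]` the path `γ` stays in a single closed cell of the graph `X`
(a vertex or an edge) and is affine with respect to the parameter of that cell. -/
def IsLinearOn (X : FiniteGraph.{u}) (γ : unitInterval → X.Realization)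
    (a b : unitInterval) : Prop :=
  (∃ x : X.V, ∀ t ∈ Set.Icc a b, γ t = X.vertexPoint x) ∨
    ∃ (e : X.E) (c d : ℝ), ∀ t ∈ Set.Icc a b,
      ∃ s : unitInterval, (s : ℝ) = c * (t : ℝ) + d ∧ γ t = X.edgePoint e s

/-- A map between graphs is piecewise linear if each edge of the source has a finite subdivision
on every segment of which the map is linear into one cell of the target. -/
def IsPiecewiseLinear {K : FiniteGraph.{w}} {X : FiniteGraph.{u}}
    (f : K.Realization → X.Realization) : Prop :=
  ∀ e : K.E, ∃ (n : ℕ) (τ : Fin (n + 1) → unitInterval),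
    Monotone τ ∧ τ 0 = 0 ∧ τ (Fin.last n) = 1 ∧
      ∀ i : Fin n, IsLinearOn X (fun t => f (K.edgePoint e t)) (τ i.castSucc) (τ i.succ)

/-- A map into a product of graphs is piecewise linear (for the product structure, whose cells are
the products of cells) if both of its coordinates are. -/
def IsPiecewiseLinearProd {K : FiniteGraph.{w}} {X : FiniteGraph.{u}} {Y : FiniteGraph.{v}}
    (φ : K.Realization → X.Realization × Y.Realization) : Prop :=
  IsPiecewiseLinear (fun p => (φ p).1) ∧ IsPiecewiseLinear (fun p => (φ p).2)

end FiniteGraph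

/-- `φ : K → X × Y` is a basic embedding: it is a topological embedding, and every continuous real
function on its image is the sum of a continuous function of the `X`-coordinate and a continuous
function of the `Y`-coordinate. -/
def IsBasicEmbedding {K : Type w} {X : Type u} {Y : Type v} [TopologicalSpace K]
    [TopologicalSpace X] [TopologicalSpace Y] (φ : K → X × Y) : Prop :=
  Topology.IsEmbedding φ ∧
    ∀ f : C(Set.range φ, ℝ), ∃ (g : C(X, ℝ)) (h : C(Y, ℝ)),
      ∀ p : Set.range φ, f p = g p.1.1 + h p.1.2

/-! Both parts follow from one fact: a star with more than `2 * X.maxDegree + 2 * Y.maxDegree` arms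
has no basic embedding into the product (`star_not_isBasicEmbedding`).

The analytic half: by the open mapping theorem, the summands g and h of a basic embedding can be
bounded by a constant times the norm of f. Consider chains of points in which consecutive points
differ and share alternately their first and their second coordinate. Prescribing the values 0, 1,
0, 1, ... along such a chain forces a summand to drift by one every two steps, so chain lengths are
bounded (`chain_length_le`).

The geometric half: near the image of the centre, X and Y consist of finitely many branches, at most
`2 * maxDegree` in each. If an arm enters a branch that no other remaining arm enters, discard the
arm together with the branch. Since arms outnumber branches, some arms are left when this stops.
Then every point close to the centre shares each of its coordinates with another point close to the
centre on the remaining arms, which yields arbitrarily long chains (`exists_hasAlternatingChain`), a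
contradiction. -/

namespace FiniteGraph

/-! ### Topology of finite graphs and of stars -/

theorem edgePoint_zero (G : FiniteGraph.{u}) (e : G.E) : G.edgePoint e 0 = G.vertexPoint (G.src e) :=
  Quot.sound (Glue.src e)

theorem edgePoint_one (G : FiniteGraph.{u}) (e : G.E) : G.edgePoint e 1 = G.vertexPoint (G.tgt e) :=
  Quot.sound (Glue.tgt e)

theorem realization_cases (G : FiniteGraph.{u}) (x : G.Realization) :
    (∃ a, x = G.vertexPoint a) ∨ ∃ e t, x = G.edgePoint e t := by
  induction x using Quot.ind with
  | mk y => rcases y with a | ⟨e, t⟩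
            · exact Or.inl ⟨a, rfl⟩
            · exact Or.inr ⟨e, t, rfl⟩

/-- A vertex, or a point in the interior of an edge. -/
theorem realization_cases_interior (G : FiniteGraph.{u}) (x : G.Realization) :
    (∃ a, x = G.vertexPoint a) ∨
      ∃ e, ∃ t : unitInterval, 0 < (t : ℝ) ∧ (t : ℝ) < 1 ∧ x = G.edgePoint e t := by
  rcases G.realization_cases x with h | ⟨e, t, rfl⟩
  · exact Or.inl h
  · rcases eq_or_ne t 0 with rfl | h0
    · exact Or.inl ⟨_, G.edgePoint_zero e⟩
    rcases eq_or_ne t 1 with rfl | h1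
    · exact Or.inl ⟨_, G.edgePoint_one e⟩
    exact Or.inr ⟨e, t, unitInterval.pos_iff_ne_zero.mpr h0, unitInterval.lt_one_iff_ne_one.mpr h1,
      rfl⟩

theorem continuous_edgePoint (G : FiniteGraph.{u}) (e : G.E) : Continuous (G.edgePoint e) :=
  continuous_quot_mk.comp (continuous_inr.comp (Continuous.prodMk_right e))

/-- The continuous function on a graph that is given on the vertices and along the edges. -/
def liftFun (G : FiniteGraph.{u}) {Z : Type*} [TopologicalSpace Z] (f : G.V → Z)
    (F : G.E → unitInterval → Z) (hF : ∀ e, Continuous (F e))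
    (h0 : ∀ e, F e 0 = f (G.src e)) (h1 : ∀ e, F e 1 = f (G.tgt e)) : C(G.Realization, Z) where
  toFun := Quot.lift (Sum.elim f fun p => F p.1 p.2) (by
    rintro _ _ (e | e)
    · exact h0 e
    · exact h1 e)
  continuous_toFun := by
    refine continuous_quot_lift _ ?_
    refine continuous_sum_dom.mpr ⟨continuous_of_discreteTopology, ?_⟩
    exact continuous_prod_of_discrete_left.mpr hF

section liftFun

variable (G : FiniteGraph.{u}) {Z : Type*} [TopologicalSpace Z] (f : G.V → Z)
    (F : G.E → unitInterval → Z) (hF : ∀ e, Continuous (F e))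
    (h0 : ∀ e, F e 0 = f (G.src e)) (h1 : ∀ e, F e 1 = f (G.tgt e))

@[simp] theorem liftFun_vertexPoint (a : G.V) :
    G.liftFun f F hF h0 h1 (G.vertexPoint a) = f a := rfl

@[simp] theorem liftFun_edgePoint (e : G.E) (t : unitInterval) :
    G.liftFun f F hF h0 h1 (G.edgePoint e t) = F e t := rfl

end liftFun

instance (G : FiniteGraph.{u}) : CompactSpace G.Realization :=
  inferInstanceAs (CompactSpace (Quot G.Glue))

/-- Coordinates on the star: the point at parameter `t` of the `i`-th edge goes to `t • eᵢ`. -/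
noncomputable def starCoord (n : ℕ) : C((starGraph n).Realization, Fin n → ℝ) :=
  (starGraph n).liftFun (fun a => a.elim 0 fun i => Pi.single i 1)
    (fun i t => Pi.single (M := fun _ : Fin n => ℝ) (show Fin n from i) (t : ℝ))
    (fun i => (continuous_single (A := fun _ : Fin n => ℝ) (show Fin n from i)).comp
      continuous_subtype_val)
    (fun _ => Pi.single_zero (M := fun _ : Fin n => ℝ) _) (fun _ => rfl)

theorem starCoord_edgePoint (n : ℕ) (i : Fin n) (t : unitInterval) :
    starCoord n ((starGraph n).edgePoint i t) = Pi.single i (t : ℝ) := rfl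

theorem star_edgePoint_eq {n : ℕ} {i j : Fin n} {s t : unitInterval}
    (h : (starGraph n).edgePoint i s = (starGraph n).edgePoint j t) (hs : 0 < (s : ℝ)) :
    i = j ∧ s = t := by
  have h' : (Pi.single i (s : ℝ) : Fin n → ℝ) = Pi.single j (t : ℝ) := congrArg (starCoord n) h
  have h2 := congrFun h' i
  by_cases hij : i = j
  · subst hij
    exact ⟨rfl, Subtype.ext (by simpa using h2)⟩
  · rw [Pi.single_eq_same, Pi.single_eq_of_ne hij] at h2
    exact absurd h2 hs.ne'

theorem star_vertexPoint_none (n : ℕ) (i : Fin n) :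
    (starGraph n).edgePoint i 0 = (starGraph n).vertexPoint none :=
  (starGraph n).edgePoint_zero i

/-- This makes the star Hausdorff and hence, being compact, normal, so that Urysohn functions are
available on it. -/
theorem starCoord_injective (n : ℕ) : Function.Injective (starCoord n) := by
  have key : ∀ x : (starGraph n).Realization, x = (starGraph n).vertexPoint none ∨
      ∃ (i : Fin n) (t : unitInterval), 0 < (t : ℝ) ∧ x = (starGraph n).edgePoint i t := by
    intro x
    rcases (starGraph n).realization_cases x with ⟨a, rfl⟩ | ⟨i, t, rfl⟩
    · rcases a with _ | i
      · exact Or.inl rfl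
      · exact Or.inr ⟨i, 1, by simp, ((starGraph n).edgePoint_one i).symm⟩
    · rcases eq_or_ne t 0 with rfl | ht
      · exact Or.inl (star_vertexPoint_none n i)
      · exact Or.inr ⟨i, t, unitInterval.pos_iff_ne_zero.mpr ht, rfl⟩
  have h0 : starCoord n ((starGraph n).vertexPoint none) = 0 := rfl
  intro x y h
  rcases key x with rfl | ⟨i, s, hs, rfl⟩ <;> rcases key y with rfl | ⟨j, t, ht, rfl⟩
  · rfl
  · rw [h0, starCoord_edgePoint] at h
    exact absurd (Pi.single_eq_zero_iff.mp h.symm) ht.ne'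
  · rw [h0, starCoord_edgePoint] at h
    exact absurd (Pi.single_eq_zero_iff.mp h) hs.ne'
  · rw [starCoord_edgePoint, starCoord_edgePoint] at h
    have h2 := congrFun h i
    by_cases hij : i = j
    · subst hij
      rw [Subtype.ext (by simpa using h2 : (s : ℝ) = t)]
    · rw [Pi.single_eq_same, Pi.single_eq_of_ne hij] at h2
      exact absurd h2 hs.ne'

instance (n : ℕ) : T2Space (starGraph n).Realization :=
  T2Space.of_injective_continuous (starCoord_injective n) (starCoord n).continuous

end FiniteGraph

/-- Near the point `x₀` the space `X` is a union of finitely many branches issuing from `x₀`,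
indexed by `D`: on the neighbourhood `{0 < T}` every point other than `x₀` has a positive coordinate
`r d`, and is determined by `d` and the value of that coordinate. -/
structure IsBranchSystem {X : Type u} [TopologicalSpace X] (x₀ : X) {D : Type v}
    (T : C(X, ℝ)) (r : D → C(X, ℝ)) : Prop where
  pos : 0 < T x₀
  zero : ∀ d, r d x₀ = 0
  inj : ∀ d x y, 0 < T x → 0 < T y → r d x = r d y → 0 < r d x → x = y
  exists_pos : ∀ x, 0 < T x → x ≠ x₀ → ∃ d, 0 < r d x

/-! ### Branches of a graph at a point -/

namespace FiniteGraph

/-- The coordinate at the source end of the edge `e`: it grows linearly on the first quarter of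
`e`, and vanishes off the first half. -/
noncomputable def srcCoord (G : FiniteGraph.{u}) (e : G.E) : C(G.Realization, ℝ) := by
  classical
  exact G.liftFun (fun _ => 0)
    (fun e' t => if e' = e then max 0 (min (t : ℝ) (1 / 2 - t)) else 0)
    (fun e' => by split_ifs <;> fun_prop)
    (fun e' => by split_ifs <;> norm_num) (fun e' => by split_ifs <;> norm_num)

/-- The coordinate at the target end of the edge `e`. -/
noncomputable def tgtCoord (G : FiniteGraph.{u}) (e : G.E) : C(G.Realization, ℝ) := by
  classical
  exact G.liftFun (fun _ => 0)
    (fun e' t => if e' = e then max 0 (min (1 - t : ℝ) (t - 1 / 2)) else 0)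
    (fun e' => by split_ifs <;> fun_prop)
    (fun e' => by split_ifs <;> norm_num) (fun e' => by split_ifs <;> norm_num)

/-- A bump function at the vertex `a`. -/
noncomputable def vertexBump (G : FiniteGraph.{u}) (a : G.V) : C(G.Realization, ℝ) := by
  classical
  exact G.liftFun (fun b => if b = a then 1 else 0)
    (fun e t => (if G.src e = a then max 0 (1 - 4 * (t : ℝ)) else 0) +
      (if G.tgt e = a then max 0 (4 * (t : ℝ) - 3) else 0))
    (fun e => by split_ifs <;> fun_prop)
    (fun e => by split_ifs <;> norm_num) (fun e => by split_ifs <;> norm_num)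

theorem vertexBump_vertexPoint_pos (G : FiniteGraph.{u}) (a b : G.V) :
    0 < G.vertexBump a (G.vertexPoint b) ↔ b = a := by
  simp only [vertexBump, liftFun_vertexPoint]
  split_ifs with h <;> simp [h]

theorem vertexBump_edgePoint_pos (G : FiniteGraph.{u}) {a : G.V} {e : G.E} {t : unitInterval}
    (h : 0 < G.vertexBump a (G.edgePoint e t)) :
    (G.src e = a ∧ (t : ℝ) < 1 / 4) ∨ (G.tgt e = a ∧ 3 / 4 < (t : ℝ)) := by
  simp only [vertexBump, liftFun_edgePoint] at h
  by_contra! hc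
  have h1 : G.src e = a → max 0 (1 - 4 * (t : ℝ)) = 0 :=
    fun hs => max_eq_left (by linarith [hc.1 hs])
  have h2 : G.tgt e = a → max 0 (4 * (t : ℝ) - 3) = 0 :=
    fun hs => max_eq_left (by linarith [hc.2 hs])
  split_ifs at h <;> simp_all

/-- Where the bump is positive, the parameter is within a quarter of an end of the edge. Positivity
of the coordinate selects the source half, and on its first quarter the tent is linear. The two
tents of a loop live on different halves, so a loop contributes two branches. -/
theorem srcCoord_pos (G : FiniteGraph.{u}) {a : G.V} {e : G.E} {x : G.Realization}
    (h : 0 < G.srcCoord e x) (hT : 0 < G.vertexBump a x) :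
    ∃ t : unitInterval, x = G.edgePoint e t ∧ G.srcCoord e x = t := by
  rcases G.realization_cases x with ⟨b, rfl⟩ | ⟨e', t, rfl⟩
  · exact absurd h (lt_irrefl _)
  · have ht := G.vertexBump_edgePoint_pos hT
    simp only [srcCoord, liftFun_edgePoint] at h ⊢
    split_ifs at h with he
    · subst he
      refine ⟨t, rfl, ?_⟩
      have h' : 0 < min (t : ℝ) (1 / 2 - t) := by
        by_contra! hc
        rw [max_eq_left hc] at h
        exact lt_irrefl _ h
      rw [if_pos rfl, max_eq_right h'.le]
      rw [lt_min_iff] at h'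
      refine min_eq_left ?_
      rcases ht with ht | ht <;> linarith [ht.2]
    · exact absurd h (lt_irrefl _)

theorem tgtCoord_pos (G : FiniteGraph.{u}) {a : G.V} {e : G.E} {x : G.Realization}
    (h : 0 < G.tgtCoord e x) (hT : 0 < G.vertexBump a x) :
    ∃ t : unitInterval, x = G.edgePoint e t ∧ G.tgtCoord e x = 1 - t := by
  rcases G.realization_cases x with ⟨b, rfl⟩ | ⟨e', t, rfl⟩
  · exact absurd h (lt_irrefl _)
  · have ht := G.vertexBump_edgePoint_pos hT
    simp only [tgtCoord, liftFun_edgePoint] at h ⊢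
    split_ifs at h with he
    · subst he
      refine ⟨t, rfl, ?_⟩
      have h' : 0 < min (1 - t : ℝ) (t - 1 / 2) := by
        by_contra! hc
        rw [max_eq_left hc] at h
        exact lt_irrefl _ h
      rw [if_pos rfl, max_eq_right h'.le]
      rw [lt_min_iff] at h'
      refine min_eq_left ?_
      rcases ht with ht | ht <;> linarith [ht.2]
    · exact absurd h (lt_irrefl _)

theorem isBranchSystem_vertexPoint (G : FiniteGraph.{u}) (a : G.V) :
    IsBranchSystem (G.vertexPoint a) (G.vertexBump a)
      (Sum.elim (fun e : {e : G.E // G.src e = a} => G.srcCoord e)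
        (fun e : {e : G.E // G.tgt e = a} => G.tgtCoord e)) where
  pos := (G.vertexBump_vertexPoint_pos a a).mpr rfl
  zero := by rintro (d | d) <;> rfl
  inj := by
    rintro (d | d) x y hx hy h hpos
    · obtain ⟨s, rfl, hs⟩ := G.srcCoord_pos hpos hx
      obtain ⟨t, rfl, ht⟩ := G.srcCoord_pos (h ▸ hpos) hy
      rw [Subtype.ext (hs.symm.trans (h.trans ht))]
    · obtain ⟨s, rfl, hs⟩ := G.tgtCoord_pos hpos hx
      obtain ⟨t, rfl, ht⟩ := G.tgtCoord_pos (h ▸ hpos) hy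
      have hst : (1 - s : ℝ) = 1 - t := hs.symm.trans (h.trans ht)
      rw [Subtype.ext (by linarith : (s : ℝ) = t)]
  exists_pos := by
    intro x hT hx
    rcases G.realization_cases_interior x with ⟨b, rfl⟩ | ⟨e, t, h0, h1, rfl⟩
    · exact absurd (congrArg _ ((G.vertexBump_vertexPoint_pos a b).mp hT)) hx
    · rcases G.vertexBump_edgePoint_pos hT with ⟨he, ht⟩ | ⟨he, ht⟩
      · refine ⟨Sum.inl ⟨e, he⟩, ?_⟩
        simp only [Sum.elim_inl, srcCoord, liftFun_edgePoint, if_pos]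
        exact lt_max_of_lt_right (lt_min h0 (by linarith))
      · refine ⟨Sum.inr ⟨e, he⟩, ?_⟩
        simp only [Sum.elim_inr, tgtCoord, liftFun_edgePoint, if_pos]
        exact lt_max_of_lt_right (lt_min (by linarith) (by linarith))

/-- A continuous function supported on one edge. -/
noncomputable def edgeFun (G : FiniteGraph.{u}) (e : G.E) (F : C(unitInterval, ℝ)) (h0 : F 0 = 0)
    (h1 : F 1 = 0) : C(G.Realization, ℝ) := by
  classical
  exact G.liftFun (fun _ => 0) (fun e' t => if e' = e then F t else 0)
    (fun e' => by split_ifs <;> fun_prop)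
    (fun e' => by split_ifs <;> simp [h0]) (fun e' => by split_ifs <;> simp [h1])

@[simp] theorem edgeFun_edgePoint (G : FiniteGraph.{u}) (e : G.E) (F : C(unitInterval, ℝ))
    (h0 : F 0 = 0) (h1 : F 1 = 0) (t : unitInterval) :
    G.edgeFun e F h0 h1 (G.edgePoint e t) = F t := by
  simp [edgeFun]

theorem edgeFun_pos (G : FiniteGraph.{u}) {e : G.E} {F : C(unitInterval, ℝ)}
    {h0 : F 0 = 0} {h1 : F 1 = 0} {x : G.Realization} (h : 0 < G.edgeFun e F h0 h1 x) :
    ∃ t, x = G.edgePoint e t := by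
  rcases G.realization_cases x with ⟨b, rfl⟩ | ⟨e', t, rfl⟩
  · exact absurd h (lt_irrefl _)
  · simp only [edgeFun, liftFun_edgePoint] at h
    split_ifs at h with he
    · exact ⟨t, he ▸ rfl⟩
    · exact absurd h (lt_irrefl _)

theorem exists_isBranchSystem_edgePoint (G : FiniteGraph.{u}) (e : G.E) (t₀ : unitInterval)
    (h0 : 0 < (t₀ : ℝ)) (h1 : (t₀ : ℝ) < 1) :
    ∃ (T : C(G.Realization, ℝ)) (r : Bool → C(G.Realization, ℝ)),
      IsBranchSystem (G.edgePoint e t₀) T r := by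
  -- The window ends at the midpoints between `t₀` and the ends of the edge, which are the peaks of
  -- the two tents below; inside it each tent is linear on its own side of `t₀`.
  let FT : C(unitInterval, ℝ) :=
    ⟨fun t => max 0 (min (t - t₀ / 2 : ℝ) ((1 + t₀) / 2 - t)), by fun_prop⟩
  let Fr : Bool → C(unitInterval, ℝ) := fun b => b.rec
    ⟨fun t => max 0 (min (t - t₀ : ℝ) (1 - t)), by fun_prop⟩
    ⟨fun t => max 0 (min (t₀ - t : ℝ) t), by fun_prop⟩
  have hT : ∀ t : unitInterval, 0 < FT t ↔ (t₀ : ℝ) / 2 < t ∧ (t : ℝ) < (1 + t₀) / 2 := by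
    intro t
    simp only [FT, ContinuousMap.coe_mk, lt_max_iff, lt_irrefl, false_or, lt_min_iff, sub_pos]
  have hr0 : ∀ t : unitInterval, 0 < FT t → Fr false t = max 0 (t - t₀ : ℝ) := by
    intro t ht
    rw [hT] at ht
    exact congrArg (max 0) (min_eq_left (by linarith))
  have hr1 : ∀ t : unitInterval, 0 < FT t → Fr true t = max 0 (t₀ - t : ℝ) := by
    intro t ht
    rw [hT] at ht
    exact congrArg (max 0) (min_eq_left (by linarith))
  have z0 : ∀ b, Fr b 0 = 0 := by
    rintro (_ | _)
    · exact max_eq_left ((min_le_left _ _).trans (by simpa using h0.le))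
    · exact max_eq_left ((min_le_right _ _).trans (by simp))
  have z1 : ∀ b, Fr b 1 = 0 := by
    rintro (_ | _)
    · exact max_eq_left ((min_le_right _ _).trans (by simp))
    · exact max_eq_left ((min_le_left _ _).trans (by simpa using h1.le))
  have hT0 : FT 0 = 0 :=
    max_eq_left ((min_le_left _ _).trans (by simpa using (half_pos h0).le))
  have hT1 : FT 1 = 0 :=
    max_eq_left ((min_le_right _ _).trans (by simp only [Set.Icc.coe_one]; linarith))
  have hpos : 0 < FT t₀ := (hT t₀).mpr ⟨by linarith, by linarith⟩
  refine ⟨G.edgeFun e FT hT0 hT1, fun b => G.edgeFun e (Fr b) (z0 b) (z1 b), ?_, ?_, ?_, ?_⟩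
  · simpa using hpos
  · rintro (_ | _)
    · simp [hr0 _ hpos]
    · simp [hr1 _ hpos]
  · rintro b x y hx hy h hb
    obtain ⟨s, rfl⟩ := G.edgeFun_pos hx
    obtain ⟨t, rfl⟩ := G.edgeFun_pos hy
    simp only [edgeFun_edgePoint] at hx hy h hb
    congr 1
    apply Subtype.ext
    have hb' := h ▸ hb
    rcases b with _ | _
    · rw [hr0 _ hx, hr0 _ hy] at h
      rw [hr0 _ hx, lt_max_iff] at hb
      rw [hr0 _ hy, lt_max_iff] at hb'
      simp only [lt_irrefl, false_or] at hb hb'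
      rw [max_eq_right hb.le, max_eq_right hb'.le] at h
      linarith
    · rw [hr1 _ hx, hr1 _ hy] at h
      rw [hr1 _ hx, lt_max_iff] at hb
      rw [hr1 _ hy, lt_max_iff] at hb'
      simp only [lt_irrefl, false_or] at hb hb'
      rw [max_eq_right hb.le, max_eq_right hb'.le] at h
      linarith
  · intro x hx hne
    obtain ⟨t, rfl⟩ := G.edgeFun_pos hx
    simp only [edgeFun_edgePoint] at hx
    have hne' : (t : ℝ) ≠ t₀ := fun h => hne (by rw [Subtype.ext h])
    rcases lt_or_gt_of_ne hne' with h | h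
    · refine ⟨true, ?_⟩
      simp only [edgeFun_edgePoint]
      rw [hr1 _ hx]
      exact lt_max_of_lt_right (by linarith)
    · refine ⟨false, ?_⟩
      simp only [edgeFun_edgePoint]
      rw [hr0 _ hx]
      exact lt_max_of_lt_right (by linarith)

theorem degree_le_maxDegree (G : FiniteGraph.{u}) (a : G.V) : G.degree a ≤ G.maxDegree :=
  Finset.le_sup (f := G.degree) (Finset.mem_univ a)

theorem one_le_maxDegree (G : FiniteGraph.{u}) (e : G.E) : 1 ≤ G.maxDegree := by
  refine le_trans ?_ (G.degree_le_maxDegree (G.src e))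
  have : Nonempty {e' : G.E // G.src e' = G.src e} := ⟨⟨e, rfl⟩⟩
  have := Nat.card_pos (α := {e' : G.E // G.src e' = G.src e})
  unfold degree
  omega

/-- At every point a graph has at most `2 * maxDegree` branches. -/
theorem exists_isBranchSystem (G : FiniteGraph.{u}) (x : G.Realization) :
    ∃ (D : Type u) (_ : Finite D) (T : C(G.Realization, ℝ)) (r : D → C(G.Realization, ℝ)),
      Nat.card D ≤ 2 * G.maxDegree ∧ IsBranchSystem x T r := by
  rcases G.realization_cases_interior x with ⟨a, rfl⟩ | ⟨e, t, h0, h1, rfl⟩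
  · refine ⟨_, inferInstance, _, _, ?_, G.isBranchSystem_vertexPoint a⟩
    rw [Nat.card_sum]
    have := G.degree_le_maxDegree a
    unfold degree at this
    omega
  · obtain ⟨T, r, h⟩ := G.exists_isBranchSystem_edgePoint e t h0 h1
    refine ⟨ULift Bool, inferInstance, T, fun b => r b.down, ?_, h.pos, fun d => h.zero _,
      fun d => h.inj _, fun y hy hne => ?_⟩
    -- An interior point has two branches; the factor 2 in the bound covers this case even when
    -- `maxDegree` is 1.
    · have := G.one_le_maxDegree e
      simp
      omega
    · obtain ⟨d, hd⟩ := h.exists_pos y hy hne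
      exact ⟨⟨d⟩, hd⟩

end FiniteGraph

/-! ### Bounded decompositions from the open mapping theorem -/

/-- Every continuous function bounded by `1` is a sum of two functions bounded by `C` that are
constant on the classes of `S true` and of `S false`, respectively. -/
def HasBoundedDecomposition {K : Type*} [TopologicalSpace K] (S : Bool → Setoid K) (C : ℝ) : Prop :=
  ∀ f : C(K, ℝ), (∀ z, |f z| ≤ 1) → ∃ G : Bool → K → ℝ,
    (∀ c z w, (S c).r z w → G c z = G c w) ∧ (∀ c z, f z = G c z + G (!c) z) ∧ ∀ c z, |G c z| ≤ C

/-- The two equivalence relations on the source of a map into a product: having the same first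
coordinate (`true`), and having the same second coordinate (`false`). -/
def fiberSetoid {K : Type*} {X : Type*} {Y : Type*} (φ : K → X × Y) (c : Bool) : Setoid K :=
  c.rec (Setoid.ker fun z => (φ z).2) (Setoid.ker fun z => (φ z).1)

theorem fiberSetoid_true {K X Y : Type*} {φ : K → X × Y} {z w : K} :
    (fiberSetoid φ true).r z w ↔ (φ z).1 = (φ w).1 := Iff.rfl

theorem fiberSetoid_false {K X Y : Type*} {φ : K → X × Y} {z w : K} :
    (fiberSetoid φ false).r z w ↔ (φ z).2 = (φ w).2 := Iff.rfl

theorem IsBasicEmbedding.exists_hasBoundedDecomposition {K : Type w} {X : Type u} {Y : Type v}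
    [TopologicalSpace K] [TopologicalSpace X] [TopologicalSpace Y] [CompactSpace K] [CompactSpace X]
    [CompactSpace Y] {φ : K → X × Y} (hφ : IsBasicEmbedding φ) :
    ∃ C, HasBoundedDecomposition (fiberSetoid φ) C := by
  obtain ⟨hemb, hdec⟩ := hφ
  let p : C(K, X) := ⟨fun z => (φ z).1, continuous_fst.comp hemb.continuous⟩
  let q : C(K, Y) := ⟨fun z => (φ z).2, continuous_snd.comp hemb.continuous⟩
  let L : C(X, ℝ) × C(Y, ℝ) →L[ℝ] C(K, ℝ) :=
    (p.compCLM ℝ ℝ).coprod (q.compCLM ℝ ℝ)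
  have hL : ∀ g h z, L (g, h) z = g (φ z).1 + h (φ z).2 := fun g h z => rfl
  have hsurj : Function.Surjective L := by
    intro f
    obtain ⟨g, h, hgh⟩ := hdec (f.comp (hemb.toHomeomorph.symm : C(Set.range φ, K)))
    refine ⟨(g, h), ContinuousMap.ext fun z => ?_⟩
    rw [hL, ← hgh ⟨φ z, Set.mem_range_self z⟩]
    exact congrArg f (hemb.toHomeomorph.symm_apply_apply z)
  -- Open mapping theorem: a surjective operator between Banach spaces has preimages of controlled
  -- norm.
  obtain ⟨C, hC, hpre⟩ := L.exists_preimage_norm_le hsurj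
  refine ⟨C, fun f hf => ?_⟩
  obtain ⟨⟨g, h⟩, hgh, hn⟩ := hpre f
  have hf1 : ‖f‖ ≤ 1 := (ContinuousMap.norm_le f zero_le_one).mpr hf
  have hn' : ‖(g, h)‖ ≤ C := hn.trans (mul_le_of_le_one_right hC.le hf1)
  rw [Prod.norm_def] at hn'
  have hz : ∀ z, f z = g (φ z).1 + h (φ z).2 := fun z => by rw [← hgh, hL]
  refine ⟨fun c z => c.rec (h (φ z).2) (g (φ z).1), ?_, ?_, ?_⟩
  · rintro (_ | _) z w hzw
    · exact congrArg h (fiberSetoid_false.mp hzw)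
    · exact congrArg g (fiberSetoid_true.mp hzw)
  · rintro (_ | _) z
    · rw [hz, add_comm]; rfl
    · rw [hz]; rfl
  · rintro (_ | _) z
    · exact (h.norm_coe_le_norm _).trans ((le_max_right _ _).trans hn')
    · exact (g.norm_coe_le_norm _).trans ((le_max_left _ _).trans hn')

/-! ### Alternating chains have bounded length -/

section Alternating

variable {K : Type*} [TopologicalSpace K] [NormalSpace K] [T1Space K]
  {S : Bool → Setoid K} {C : ℝ}

/-- There is no closed alternating chain `u 0, …, u m` (with `m` odd). -/
theorem HasBoundedDecomposition.not_closed_chain (hS : HasBoundedDecomposition S C) {c : ℕ → Bool}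
    {u : ℕ → K} (hc : ∀ k, c (k + 1) = !c k) {m : ℕ} (hm : Odd m)
    (hu : ∀ k < m, (S (c k)).r (u k) (u (k + 1))) (hlast : (S (c m)).r (u m) (u 0))
    (hne : ∀ k, 0 < k → k ≤ m → u k ≠ u 0) : False := by
  obtain ⟨f, h0, h1, hI⟩ := exists_continuous_zero_one_of_isClosed
    (s := u '' Set.Ioc 0 m) (t := {u 0}) ((Set.finite_Ioc 0 m).image u).isClosed
    isClosed_singleton (by
      rw [Set.disjoint_singleton_right]
      rintro ⟨k, hk, hk'⟩
      exact hne k hk.1 hk.2 hk')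
  obtain ⟨G, hG, hfG, -⟩ := hS f fun z => abs_le.mpr ⟨by linarith [(hI z).1], (hI z).2⟩
  -- With f equal to 1 at `u 0` and 0 at the other points, the summands change sign at every step.
  -- As `m` is odd, the two summands at `u 0` then cancel, although f is 1 there.
  have key : ∀ k ≤ m, G (c k) (u k) = (-1) ^ k * G (c 0) (u 0) := by
    intro k
    induction k with
    | zero => simp
    | succ k ih =>
      intro hk
      have e1 := hfG (c (k + 1)) (u (k + 1))
      rw [h0 ⟨k + 1, ⟨k.succ_pos, hk⟩, rfl⟩, hc k, Bool.not_not, ← hG _ _ _ (hu k hk), ih (by omega),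
        ← hc k] at e1
      simp only [Pi.zero_apply] at e1
      rw [pow_succ]
      linarith
  have hc2 : ∀ l, c (2 * l) = c 0 := by
    intro l
    induction l with
    | zero => rfl
    | succ l ih => rw [mul_add, mul_one, hc, hc, Bool.not_not, ih]
  have hcm : c m = !c 0 := by
    obtain ⟨l, rfl⟩ := hm
    rw [hc, hc2]
  have e := hfG (c 0) (u 0)
  rw [h1 rfl, ← hcm, ← hG _ _ _ hlast, key m le_rfl, hm.neg_one_pow] at e
  simp at e

/-- Alternating chains have no repetitions. -/
theorem HasBoundedDecomposition.chain_ne (hS : HasBoundedDecomposition S C) {c : ℕ → Bool}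
    {u : ℕ → K} (hc : ∀ k, c (k + 1) = !c k) {n : ℕ} (hstep : ∀ k < n, u (k + 1) ≠ u k)
    (hu : ∀ k < n, (S (c k)).r (u k) (u (k + 1))) :
    ∀ d, 0 < d → ∀ i, i + d ≤ n → u (i + d) ≠ u i := by
  have hc2 : ∀ l i, c (i + 2 * l) = c i := by
    intro l i
    induction l with
    | zero => rfl
    | succ l ih => rw [mul_add, mul_one, ← add_assoc, hc, hc, Bool.not_not, ih]
  intro d
  induction d using Nat.strong_induction_on with
  | _ d ih =>
    intro hd i hi heq
    rcases Nat.even_or_odd' d with ⟨l, rfl | rfl⟩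
    -- Even gap: the points from `u i` to `u (i + d - 1)` already form a closed chain.
    · refine hS.not_closed_chain (c := fun k => c (i + k)) (u := fun k => u (i + k))
        (fun k => hc _) (m := 2 * l - 1) ⟨l - 1, by omega⟩ (fun k hk => hu _ (by omega)) ?_
        (fun k h0 hk => ih k (by omega) h0 i (by omega))
      have := hu (i + (2 * l - 1)) (by omega)
      rw [show i + (2 * l - 1) + 1 = i + 2 * l by omega, heq] at this
      exact this
    · rcases Nat.eq_zero_or_pos l with rfl | hl
      · exact hstep i (by omega) heq
      -- Odd gap: the first and last steps have the same colour and meet at the repeated point.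
      -- Transitivity merges them, and dropping that point leaves a closed chain.
      refine hS.not_closed_chain (c := fun k => c (i + 1 + k)) (u := fun k => u (i + 1 + k))
        (fun k => hc _) (m := 2 * l - 1) ⟨l - 1, by omega⟩ (fun k hk => hu _ (by omega)) ?_
        (fun k h0 hk => ih k (by omega) h0 (i + 1) (by omega))
      have h2 := hu (i + 1 + (2 * l - 1)) (by omega)
      rw [show i + 1 + (2 * l - 1) + 1 = i + (2 * l + 1) by omega, heq] at h2
      refine (S _).iseqv.trans h2 ?_
      rw [show i + 1 + (2 * l - 1) = i + 2 * l by omega, hc2]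
      exact hu i (by omega)

/-- The length of alternating chains is bounded. -/
theorem HasBoundedDecomposition.chain_length_le (hS : HasBoundedDecomposition S C) {c : ℕ → Bool}
    {u : ℕ → K} (hc : ∀ k, c (k + 1) = !c k) {n : ℕ} (hstep : ∀ k < 2 * n, u (k + 1) ≠ u k)
    (hu : ∀ k < 2 * n, (S (c k)).r (u k) (u (k + 1))) : (n : ℝ) ≤ 2 * C + 1 := by
  have hne := hS.chain_ne hc hstep hu
  obtain ⟨f, h0, h1, hI⟩ := exists_continuous_zero_one_of_isClosed
    (s := u '' {k | k ≤ 2 * n ∧ Even k}) (t := u '' {k | k ≤ 2 * n ∧ Odd k})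
    (((Set.finite_Iic (2 * n)).subset fun k hk => hk.1).image u).isClosed
    (((Set.finite_Iic (2 * n)).subset fun k hk => hk.1).image u).isClosed (by
      rw [Set.disjoint_left]
      rintro _ ⟨k, ⟨hk, hk2⟩, rfl⟩ ⟨l, ⟨hl, hl2⟩, hkl⟩
      rcases lt_trichotomy k l with h | rfl | h
      · exact hne (l - k) (by omega) k (by omega) (by rw [Nat.add_sub_cancel' h.le, hkl])
      · exact (Nat.not_even_iff_odd.mpr hl2) hk2
      · exact hne (k - l) (by omega) l (by omega) (by rw [Nat.add_sub_cancel' h.le, hkl]))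
  obtain ⟨G, hG, hfG, hC⟩ := hS f fun z => abs_le.mpr ⟨by linarith [(hI z).1], (hI z).2⟩
  have hrec : ∀ k < 2 * n, f (u (k + 1)) = G (c k) (u k) + G (c (k + 1)) (u (k + 1)) := by
    intro k hk
    rw [hG _ _ _ (hu k hk), hfG (c k), hc k]
  -- Here f is 0 at even and 1 at odd indices, so two steps lower the summand by 1, while it must
  -- stay in `[-C, C]`.
  have key : ∀ k ≤ n, G (c (2 * k)) (u (2 * k)) = G (c 0) (u 0) - k := by
    intro k
    induction k with
    | zero => simp
    | succ k ih =>
      intro hk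
      have e1 := hrec (2 * k) (by omega)
      have e2 := hrec (2 * k + 1) (by omega)
      rw [h1 ⟨2 * k + 1, ⟨by omega, ⟨k, rfl⟩⟩, rfl⟩, ih (by omega)] at e1
      rw [h0 ⟨2 * k + 1 + 1, ⟨by omega, ⟨k + 1, by ring⟩⟩, rfl⟩] at e2
      simp only [Pi.one_apply, Pi.zero_apply] at e1 e2
      rw [mul_add, mul_one]
      push_cast
      linarith
  have b1 := (abs_le.mp (hC (c 0) (u 0))).2
  have b2 := (abs_le.mp (hC (c (2 * n)) (u (2 * n)))).1
  rw [key n le_rfl] at b2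
  linarith

end Alternating

/-- There is an alternating chain of `n` steps from `z` whose first step is within a class
of `S c`. -/
def HasAlternatingChain {K : Type*} (S : Bool → Setoid K) : ℕ → Bool → K → Prop
  | 0, _, _ => True
  | n + 1, c, z => ∃ w, w ≠ z ∧ (S c).r z w ∧ HasAlternatingChain S n (!c) w

theorem HasAlternatingChain.exists_seq {K : Type*} {S : Bool → Setoid K} {n : ℕ} {b : Bool} {z : K}
    (h : HasAlternatingChain S n b z) : ∃ (c : ℕ → Bool) (u : ℕ → K), c 0 = b ∧ u 0 = z ∧
      (∀ k, c (k + 1) = !c k) ∧ (∀ k < n, u (k + 1) ≠ u k) ∧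
      ∀ k < n, (S (c k)).r (u k) (u (k + 1)) := by
  induction n generalizing b z with
  | zero =>
    exact ⟨fun k => (!·)^[k] b, fun _ => z, rfl, rfl,
      fun k => Function.iterate_succ_apply' (!·) k b, by simp, by simp⟩
  | succ n ih =>
    obtain ⟨w, hwz, hzw, hw⟩ := h
    obtain ⟨c, u, hc0, hu0, hc, hne, hu⟩ := ih hw
    refine ⟨fun k => k.casesOn b c, fun k => k.casesOn z u, rfl, rfl, ?_, ?_, ?_⟩
    · rintro (_ | k)
      · exact hc0
      · exact hc k
    · rintro (_ | k) hk
      · exact (congrArg (· ≠ z) hu0).mpr hwz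
      · exact hne k (by omega)
    · rintro (_ | k) hk
      · exact (congrArg (fun x => (S b).r z x) hu0).mpr hzw
      · exact hu k (by omega)

theorem HasBoundedDecomposition.exists_not_hasAlternatingChain {K : Type*} [TopologicalSpace K]
    [NormalSpace K] [T1Space K] {S : Bool → Setoid K} {C : ℝ} (hS : HasBoundedDecomposition S C) :
    ∃ n, ∀ b z, ¬ HasAlternatingChain S n b z := by
  obtain ⟨n, hn⟩ := exists_nat_gt (2 * C + 1)
  refine ⟨2 * n, fun b z h => ?_⟩
  obtain ⟨c, u, -, -, hc, hne, hu⟩ := h.exists_seq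
  exact absurd (hS.chain_length_le hc hne hu) (not_le.mpr hn)
-- Arms, directions and long chains
/-- The arms `α i` issue from `α i 0 = a`; up to the parameter `ε₀` they are injective and disjoint,
and the classes of `S c` on them are governed by the coordinates `r d` with `col d = c`. -/
structure IsArmSystem {K ι D : Type*} (S : Bool → Setoid K) (a : K) (α : ι → ℝ → K)
    (col : D → Bool) (r : D → K → ℝ) (ε₀ : ℝ) : Prop where
  cont : ∀ d i, Continuous fun t => r d (α i t)
  zero : ∀ d i, r d (α i 0) = 0
  inj : ∀ i j s t, 0 < s → s ≤ ε₀ → 0 < t → t ≤ ε₀ → α i s = α j t → i = j ∧ s = t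
  related : ∀ d i j s t, 0 < s → s ≤ ε₀ → 0 < t → t ≤ ε₀ → r d (α i s) = r d (α j t) →
    0 < r d (α i s) → (S (col d)).r (α i s) (α j t)
  exists_pos : ∀ c i s, 0 < s → s ≤ ε₀ → ¬ (S c).r a (α i s) → ∃ d, col d = c ∧ 0 < r d (α i s)

namespace IsArmSystem

open Filter Topology

variable {K ι D : Type*} {S : Bool → Setoid K} {a : K} {α : ι → ℝ → K}
    {col : D → Bool} {r : D → K → ℝ} {ε₀ : ℝ}

/-- Either all points close to the centre have neighbours of both kinds in the star, or one of the
arms reaches in some direction `d` further than the others. -/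
theorem exists_neighbour_or_direction [Finite D] (hα : IsArmSystem S a α col r ε₀) (J : Finset ι)
    {ε : ℝ} (hε : 0 < ε) (hε₀ : ε ≤ ε₀) :
    (∃ ε', 0 < ε' ∧ ε' ≤ ε ∧ ∀ i ∈ J, ∀ t, 0 < t → t ≤ ε' → ∀ c,
      ∃ j ∈ J, ∃ s, 0 < s ∧ s ≤ ε ∧ (S c).r (α i t) (α j s) ∧ α j s ≠ α i t) ∨
    ∃ i ∈ J, ∃ d, (∃ t, 0 < t ∧ t ≤ ε ∧ 0 < r d (α i t)) ∧
      ∀ j ∈ J, j ≠ i → ∀ t, 0 < t → t ≤ ε → r d (α j t) ≤ 0 := by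
  -- `P c i t`: the point has no `S c`-neighbour on the arms of `J` up to `ε`.
  set P : Bool → ι → ℝ → Prop := fun c i t =>
    ∀ j ∈ J, ∀ s, 0 < s → s ≤ ε → (S c).r (α i t) (α j s) → α j s = α i t with hP
  have hsmall : ∀ δ : ℝ, 0 < δ → ∀ᶠ t in 𝓝[>] (0 : ℝ), 0 < t ∧ t < δ :=
    fun δ hδ => Ioo_mem_nhdsGT hδ
  by_cases hev : ∀ᶠ t in 𝓝[>] (0 : ℝ), ∀ i ∈ J, ∀ c, ¬ P c i t
  · left
    obtain ⟨δ, hδ, hsub⟩ := mem_nhdsGT_iff_exists_Ioc_subset.mp hev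
    refine ⟨min δ ε, lt_min hδ hε, min_le_right _ _, fun i hi t ht0 ht c => ?_⟩
    have := hsub ⟨ht0, ht.trans (min_le_left _ _)⟩ i hi c
    simp only [hP] at this
    push Not at this
    exact this
  · right
    have hfr : ∃ᶠ t in 𝓝[>] (0 : ℝ), ∃ i ∈ J, ∃ c, P c i t := by
      intro h
      refine hev (h.mono fun t ht i hi c hPt => ht ⟨i, hi, c, hPt⟩)
    rw [frequently_exists_finset] at hfr
    obtain ⟨i, hi, hfr⟩ := hfr
    rw [frequently_exists] at hfr
    obtain ⟨c, hfr⟩ := hfr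
    -- Two such points in the class of the centre would be neighbours of each other.
    have hnr : ∀ᶠ t in 𝓝[>] (0 : ℝ), P c i t → ¬ (S c).r a (α i t) := by
      by_contra hcon
      have hcon : ∃ᶠ t in 𝓝[>] (0 : ℝ), P c i t ∧ (S c).r a (α i t) :=
        (not_eventually.mp hcon).mono fun t ht => by simpa using ht
      obtain ⟨t₁, ⟨hPt, hr₁⟩, h1, h1'⟩ := (hcon.and_eventually (hsmall ε hε)).exists
      obtain ⟨t₂, ⟨-, hr₂⟩, h2, h2'⟩ := (hcon.and_eventually (hsmall t₁ h1)).exists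
      have := hPt i hi t₂ h2 (by linarith) ((S c).iseqv.trans ((S c).iseqv.symm hr₁) hr₂)
      exact h2'.ne (hα.inj i i t₂ t₁ h2 (by linarith) h1 (by linarith) this).2
    have hfr2 : ∃ᶠ t in 𝓝[>] (0 : ℝ), ∃ d, P c i t ∧ col d = c ∧ 0 < r d (α i t) := by
      refine ((hfr.and_eventually hnr).and_eventually (hsmall ε hε)).mono ?_
      rintro t ⟨⟨hPt, ht⟩, h0, h1⟩
      obtain ⟨d, hd, hpos⟩ := hα.exists_pos c i t h0 (by linarith) (ht hPt)
      exact ⟨d, hPt, hd, hpos⟩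
    rw [frequently_exists] at hfr2
    obtain ⟨d, hfr2⟩ := hfr2
    refine ⟨i, hi, d, ?_, fun j hj hji t ht0 ht => ?_⟩
    · obtain ⟨t, ⟨-, -, hpos⟩, h0, h1⟩ := (hfr2.and_eventually (hsmall ε hε)).exists
      exact ⟨t, h0, h1.le, hpos⟩
    -- If arm `j` also entered direction `d`, then by the intermediate value theorem it would attain
    -- every small positive value of `r d`, in particular that of an isolated point of arm `i` close
    -- enough to the centre.
    · by_contra! hpos
      have hlim : Tendsto (fun t => r d (α i t)) (𝓝[>] 0) (𝓝 0) := by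
        have := (hα.cont d i).tendsto 0
        rw [hα.zero] at this
        exact this.mono_left nhdsWithin_le_nhds
      obtain ⟨s, ⟨⟨hPs, hcol, hs⟩, hlt⟩, hs0, hs1⟩ := ((hfr2.and_eventually
        (hlim.eventually_lt_const hpos)).and_eventually (hsmall ε hε)).exists
      obtain ⟨t', ⟨h0', ht'⟩, heq⟩ := intermediate_value_Icc ht0.le (hα.cont d j).continuousOn
        (show r d (α i s) ∈ Set.Icc (r d (α j 0)) (r d (α j t)) from
          ⟨by rw [hα.zero]; exact hs.le, hlt.le⟩)
      have hne : 0 ≠ t' := by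
        rintro rfl
        simp only [hα.zero] at heq
        exact hs.ne heq
      have hpos' := lt_of_le_of_ne h0' hne
      have hrel := hα.related d i j s t' hs0 (by linarith) hpos' (by linarith) heq.symm hs
      rw [hcol] at hrel
      have := hPs j hj t' hpos' (by linarith) hrel
      exact hji (hα.inj j i t' s hpos' (by linarith) hs0 (by linarith) this).1

/-- If there are more arms than directions then there are alternating chains of any length. -/
theorem exists_hasAlternatingChain [Finite D] (hα : IsArmSystem S a α col r ε₀) (n : ℕ)
    (J : Finset ι) (A : Finset D) (hcard : A.card < J.card) {ε : ℝ} (hε : 0 < ε) (hε₀ : ε ≤ ε₀)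
    (hA : ∀ d ∉ A, ∀ j ∈ J, ∀ t, 0 < t → t ≤ ε → r d (α j t) ≤ 0) :
    ∃ b z, HasAlternatingChain S n b z := by
  classical
  induction hm : J.card generalizing J A ε with
  | zero => omega
  | succ m ih =>
    -- If some scale has an arm with a private direction, both are removed and `A.card < J.card`
    -- persists. Otherwise the neighbour alternative holds at every scale.
    by_cases hdir : ∃ ε', 0 < ε' ∧ ε' ≤ ε ∧ ∃ i ∈ J, ∃ d, (∃ t, 0 < t ∧ t ≤ ε' ∧ 0 < r d (α i t)) ∧
      ∀ j ∈ J, j ≠ i → ∀ t, 0 < t → t ≤ ε' → r d (α j t) ≤ 0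
    · obtain ⟨ε', h0, hle, i, hi, d, ⟨t, ht0, ht, hpos⟩, hd⟩ := hdir
      have hdA : d ∈ A := by
        by_contra hdA
        exact absurd (hA d hdA i hi t ht0 (ht.trans hle)) (not_le.mpr hpos)
      have c1 := Finset.card_erase_of_mem hi
      have c2 := Finset.card_erase_of_mem hdA
      have c3 := Finset.card_pos.mpr ⟨d, hdA⟩
      refine ih (J.erase i) (A.erase d) (by omega) h0 (hle.trans hε₀) ?_ (by omega)
      intro d' hd' j hj s hs0 hs
      obtain ⟨hji, hj⟩ := Finset.mem_erase.mp hj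
      by_cases h : d' = d
      · exact h ▸ hd j hj hji s hs0 hs
      · exact hA d' (fun h' => hd' (Finset.mem_erase.mpr ⟨h, h'⟩)) j hj s hs0 (hs.trans hle)
    -- Each further step of the chain needs a smaller start: points up to `ε'` have neighbours up to
    -- `δ`, from which chains of length `n` are known to exist.
    · have hstep : ∀ n, ∃ ε', 0 < ε' ∧ ε' ≤ ε ∧ ∀ i ∈ J, ∀ t, 0 < t → t ≤ ε' → ∀ c,
          HasAlternatingChain S n c (α i t) := by
        intro n
        induction n with
        | zero => exact ⟨ε, hε, le_rfl, fun _ _ _ _ _ _ => trivial⟩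
        | succ n ihn =>
          obtain ⟨δ, hδ0, hδ, hchain⟩ := ihn
          rcases hα.exists_neighbour_or_direction J hδ0 (hδ.trans hε₀) with h | h
          · obtain ⟨ε', h0, hle, hnb⟩ := h
            refine ⟨ε', h0, hle.trans hδ, fun i hi t ht0 ht c => ?_⟩
            obtain ⟨j, hj, s, hs0, hs, hrel, hne⟩ := hnb i hi t ht0 ht c
            exact ⟨α j s, hne, hrel, hchain j hj s hs0 hs _⟩
          · exact absurd ⟨δ, hδ0, hδ, h⟩ hdir
      obtain ⟨ε', h0, -, hchain⟩ := hstep n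
      obtain ⟨i, hi⟩ : J.Nonempty := Finset.card_pos.mp (by omega)
      exact ⟨true, _, hchain i hi ε' h0 le_rfl true⟩

end IsArmSystem

/-! ### Stars with too many arms -/

namespace FiniteGraph

theorem star_not_isBasicEmbedding (X : FiniteGraph.{u}) (Y : FiniteGraph.{v}) {n : ℕ}
    (hn : 2 * X.maxDegree + 2 * Y.maxDegree < n)
    (φ : (starGraph n).Realization → X.Realization × Y.Realization) : ¬ IsBasicEmbedding φ := by
  intro hφ
  obtain ⟨C, hC⟩ := hφ.exists_hasBoundedDecomposition
  obtain ⟨N, hN⟩ := hC.exists_not_hasAlternatingChain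
  have hcont := hφ.1.continuous
  set a : (starGraph n).Realization := (starGraph n).vertexPoint none
  obtain ⟨D₁, _, T₁, r₁, hD₁, h₁⟩ := X.exists_isBranchSystem (φ a).1
  obtain ⟨D₂, _, T₂, r₂, hD₂, h₂⟩ := Y.exists_isBranchSystem (φ a).2
  -- The parameter is clamped to the unit interval, so the arms are defined on all of ℝ; only
  -- parameters up to `ε ≤ 1` matter.
  let α : Fin n → ℝ → (starGraph n).Realization := fun i t =>
    (starGraph n).edgePoint i (Set.projIcc 0 1 zero_le_one t)
  have hα : ∀ i, Continuous (α i) := fun i =>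
    ((starGraph n).continuous_edgePoint i).comp continuous_projIcc
  have hα0 : ∀ i, α i 0 = a := fun i => by
    simp only [α, Set.projIcc_left]
    exact star_vertexPoint_none n i
  obtain ⟨ε, hε, hε1, hT⟩ : ∃ ε : ℝ, 0 < ε ∧ ε ≤ 1 ∧ ∀ i t, 0 < t → t ≤ ε →
      0 < T₁ (φ (α i t)).1 ∧ 0 < T₂ (φ (α i t)).2 := by
    have hev : ∀ᶠ t in nhdsWithin (0 : ℝ) (Set.Ioi 0), ∀ i,
        0 < T₁ (φ (α i t)).1 ∧ 0 < T₂ (φ (α i t)).2 := by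
      refine Filter.eventually_all.mpr fun i => ?_
      have c1 : Continuous fun t => T₁ (φ (α i t)).1 :=
        T₁.continuous.comp (continuous_fst.comp (hcont.comp (hα i)))
      have c2 : Continuous fun t => T₂ (φ (α i t)).2 :=
        T₂.continuous.comp (continuous_snd.comp (hcont.comp (hα i)))
      refine nhdsWithin_le_nhds ((c1.continuousAt.eventually_const_lt ?_).and
        (c2.continuousAt.eventually_const_lt ?_))
      · simpa only [hα0] using h₁.pos
      · simpa only [hα0] using h₂.pos
    obtain ⟨δ, hδ, hsub⟩ := mem_nhdsGT_iff_exists_Ioc_subset.mp hev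
    exact ⟨min δ 1, lt_min hδ one_pos, min_le_right _ _,
      fun i t h0 ht => hsub ⟨h0, ht.trans (min_le_left _ _)⟩ i⟩
  have hsys : IsArmSystem (D := D₁ ⊕ D₂) (fiberSetoid φ) a α (Sum.elim (fun _ => true) fun _ => false)
      (Sum.elim (fun d z => r₁ d (φ z).1) fun d z => r₂ d (φ z).2) ε := by
    refine ⟨?_, ?_, ?_, ?_, ?_⟩
    · rintro (d | d) i
      · exact (r₁ d).continuous.comp (continuous_fst.comp (hcont.comp (hα i)))
      · exact (r₂ d).continuous.comp (continuous_snd.comp (hcont.comp (hα i)))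
    · rintro (d | d) i
      · simpa [hα0] using h₁.zero d
      · simpa [hα0] using h₂.zero d
    · intro i j s t hs0 hs ht0 ht h
      have hs' : s ∈ Set.Icc (0 : ℝ) 1 := ⟨hs0.le, hs.trans hε1⟩
      have ht' : t ∈ Set.Icc (0 : ℝ) 1 := ⟨ht0.le, ht.trans hε1⟩
      simp only [α, Set.projIcc_of_mem _ hs', Set.projIcc_of_mem _ ht'] at h
      obtain ⟨hij, hst⟩ := star_edgePoint_eq h hs0
      exact ⟨hij, congrArg Subtype.val hst⟩
    · rintro (d | d) i j s t hs0 hs ht0 ht h hpos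
      · exact h₁.inj d _ _ (hT i s hs0 hs).1 (hT j t ht0 ht).1 h hpos
      · exact h₂.inj d _ _ (hT i s hs0 hs).2 (hT j t ht0 ht).2 h hpos
    · rintro (_ | _) i s hs0 hs h
      · obtain ⟨d, hd⟩ := h₂.exists_pos _ (hT i s hs0 hs).2 (fun h' => h h'.symm)
        exact ⟨Sum.inr d, rfl, hd⟩
      · obtain ⟨d, hd⟩ := h₁.exists_pos _ (hT i s hs0 hs).1 (fun h' => h h'.symm)
        exact ⟨Sum.inl d, rfl, hd⟩
  have := Fintype.ofFinite (D₁ ⊕ D₂)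
  obtain ⟨b, z, hbz⟩ := hsys.exists_hasAlternatingChain N Finset.univ Finset.univ (by
    rw [Finset.card_univ, Finset.card_univ, Fintype.card_fin, ← Nat.card_eq_fintype_card,
      Nat.card_sum]
    omega) hε le_rfl (fun d hd => absurd (Finset.mem_univ d) hd)
  exact hN b z hbz

end FiniteGraph

theorem mainTheorem6 (X : FiniteGraph.{u}) (Y : FiniteGraph.{v}) :
    (∃ K : FiniteGraph.{0},
      ¬ ∃ φ : K.Realization → X.Realization × Y.Realization, IsBasicEmbedding φ) ∧
    (∀ k : ℕ, k = max X.maxDegree Y.maxDegree →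
      ¬ ∃ φ : (FiniteGraph.starGraph (4 * k ^ 2 + 1)).Realization → X.Realization × Y.Realization,
        IsBasicEmbedding φ ∧ FiniteGraph.IsPiecewiseLinearProd φ) := by
  refine ⟨⟨FiniteGraph.starGraph (2 * X.maxDegree + 2 * Y.maxDegree + 1), fun ⟨φ, hφ⟩ =>
    FiniteGraph.star_not_isBasicEmbedding X Y (Nat.lt_succ_self _) φ hφ⟩, ?_⟩
  rintro k hk ⟨φ, hφ, -⟩
  refine FiniteGraph.star_not_isBasicEmbedding X Y ?_ φ hφ
  have h1 : X.maxDegree ≤ k := hk ▸ le_max_left _ _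
  have h2 : Y.maxDegree ≤ k := hk ▸ le_max_right _ _
  -- The number of directions is at most `4 * k`, hence at most `4 * k ^ 2`, also for `k = 0`.
  have h3 : k ≤ k ^ 2 := Nat.le_self_pow two_ne_zero k
  omega
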